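/- Let $Y$ be a homogeneous compact Hausdorff space whose weight and character both equal $\aleph_1$, let $\eta:Y\to Y$ be an autohomeomorphism and $d\in Y$ a point whose positive orbit $\{\eta^n(d):n\in\omega\}$ is dense in $Y$, and suppose that $Y$ is a retract of $\gamma\mathbb N$ whenever $\gamma\mathbb N$ is a (Hausdorff) compactification of the discrete space $\mathbb N$ with remainder (homeomorphic to) $Y$. Write $d_n=\eta^n(d)$, let $\mathcal C=2^\omega$ be the Cantor set, and for $x\in\mathcal C$ and $n\in\omega$ put $U_{x,n}=\{z\in\mathcal C: z\restriction n=x\restriction n\}$ and $C_{x,n}=U_{x,n}\setminus U_{x,n+1}$. Let $X$ be the set $\mathcal C\times Y$ with the topology in which the basic neighbourhoods of $(x,y)$ are the sets $$U_{x,n}\otimes W=\bigl(\{x\}\times W\bigr)\cup\bigcup\{C_{x,m}\times Y: m\ge n,\ d_m\in W\},$$ where $n\in\omega$ and $W$ is a neighbourhood of $y$ in $Y$. Then: 1. $X$ is compact Hausdorff; 2. the character of $X$ is $\chi(X)=\aleph_1$ and the $\pi$-weight of $X$ is $\pi(X)=\aleph_0$; 3. if $Y$ is zero-dimensional (the clopen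 sets form a base), then so is $X$; 4. if $\mathsf{MA}+\neg\mathsf{CH}$ holds, then $X$ is homogeneous; 5. more generally, if the weight of $Y$ satisfies $w(Y)<\mathfrak p$, then $X$ is homogeneous, where $\mathfrak p$ is the least cardinality of a family of subsets of $\omega$ all of whose finite subfamilies have infinite intersection but that has no infinite pseudointersection (an infinite $A\subseteq\omega$ with $A\setminus B$ finite for every member $B$ of the family); 6. if $\mathsf{CH}$ holds, then $X$ is not homogeneous. Here a space is homogeneous if for any two of its points some autohomeomorphism maps the first to the second. -/

import Mathlib

open Set Topology

universe u

/-- The least cardinality of a base for the open sets of `X`. -/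
noncomputable def topWeight (X : Type u) [TopologicalSpace X] : Cardinal.{u} :=
  sInf {κ | ∃ B : Set (Set X), TopologicalSpace.IsTopologicalBasis B ∧ Cardinal.mk B = κ}

/-- `B` is a local base at `x`. -/
def IsLocalBase {X : Type u} [TopologicalSpace X] (x : X) (B : Set (Set X)) : Prop :=
  (∀ V ∈ B, IsOpen V ∧ x ∈ V) ∧ ∀ O : Set X, IsOpen O → x ∈ O → ∃ V ∈ B, V ⊆ O

/-- The least cardinality of a local base at `x`. -/
noncomputable def pointCharacter {X : Type u} [TopologicalSpace X] (x : X) : Cardinal.{u} :=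
  sInf {κ | ∃ B : Set (Set X), IsLocalBase x B ∧ Cardinal.mk B = κ}

/-- The character of `X`: the supremum of the characters of its points. -/
noncomputable def topCharacter (X : Type u) [TopologicalSpace X] : Cardinal.{u} :=
  ⨆ x : X, pointCharacter x

/-- A pi-base: a family of nonempty open sets such that every nonempty open set contains
a member of the family. -/
def IsPiBase {X : Type u} [TopologicalSpace X] (B : Set (Set X)) : Prop :=
  (∀ V ∈ B, IsOpen V ∧ V.Nonempty) ∧ ∀ O : Set X, IsOpen O → O.Nonempty → ∃ V ∈ B, V ⊆ O

/-- The least cardinality of a pi-base of `X`. -/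
noncomputable def piWeight (X : Type u) [TopologicalSpace X] : Cardinal.{u} :=
  sInf {κ | ∃ B : Set (Set X), IsPiBase B ∧ Cardinal.mk B = κ}

/-- For any two points some autohomeomorphism maps the first to the second. -/
def IsHomogeneousSpace (X : Type u) [TopologicalSpace X] : Prop :=
  ∀ x y : X, ∃ h : X ≃ₜ X, h x = y

/-- The clopen sets form a base. -/
def IsZeroDimensional (X : Type u) [TopologicalSpace X] : Prop :=
  TopologicalSpace.IsTopologicalBasis {s : Set X | IsClopen s}

/-- `Y` is a retract of every (Hausdorff) compactification `K` of the discrete space `ℕ`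
whose remainder is (a copy of) `Y`. -/
def IsRetractOfCompactificationsOfNat (Y : Type u) [TopologicalSpace Y] : Prop :=
  ∀ (K : Type u) [TopologicalSpace K] [CompactSpace K] [T2Space K] (i : ℕ → K) (j : Y → K),
    IsEmbedding i → DenseRange i → IsEmbedding j → range j = (range i)ᶜ →
      ∃ r : K → Y, Continuous r ∧ ∀ y, r (j y) = y

/-- `CH`. -/
def ContinuumHypothesis : Prop :=
  Cardinal.aleph.{0} 1 = Cardinal.continuum.{0}

/-- Elements of a preorder that have a common lower bound. -/
def ForcingCompatible {P : Type} [Preorder P] (p q : P) : Prop :=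
  ∃ r : P, r ≤ p ∧ r ≤ q

/-- `MA`: for every nonempty ccc preorder and every family of fewer than continuum many dense
subsets of it there is a filter that meets every member of the family. -/
def MartinsAxiom : Prop :=
  ∀ (P : Type) [Preorder P] [Nonempty P],
    (∀ A : Set P, A.Pairwise (fun p q => ¬ ForcingCompatible p q) → A.Countable) →
    ∀ 𝒟 : Set (Set P), Cardinal.mk 𝒟 < Cardinal.continuum →
      (∀ D ∈ 𝒟, ∀ p : P, ∃ q ∈ D, q ≤ p) →
      ∃ G : Set P, G.Nonempty ∧ (∀ p ∈ G, ∀ q, p ≤ q → q ∈ G) ∧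
        (∀ p ∈ G, ∀ q ∈ G, ∃ r ∈ G, r ≤ p ∧ r ≤ q) ∧ ∀ D ∈ 𝒟, (G ∩ D).Nonempty

/-- The cardinal `𝔭`: the least cardinality of a family of subsets of `ℕ` all of whose finite
subfamilies have infinite intersection, but that has no infinite pseudointersection. -/
noncomputable def pseudointersectionNumber : Cardinal.{0} :=
  sInf {κ | ∃ F : Set (Set ℕ),
    (∀ T : Set (Set ℕ), T ⊆ F → T.Finite → (⋂₀ T).Infinite) ∧
    (¬ ∃ A : Set ℕ, A.Infinite ∧ ∀ B ∈ F, (A \ B).Finite) ∧ Cardinal.mk F = κ}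

/-- The underlying set `2^ω × Y` of the resolution of the Cantor set determined by an
autohomeomorphism `η` of `Y` and a point `d` of `Y`. -/
@[nolint unusedArguments]
def CantorResolution {Y : Type u} [TopologicalSpace Y] (_η : Y ≃ₜ Y) (_d : Y) : Type u :=
  (ℕ → Bool) × Y

namespace CantorResolution

variable {Y : Type u} [TopologicalSpace Y]

/-- `U_{x,n}`: the points of the Cantor set that agree with `x` below `n`. -/
def U (x : ℕ → Bool) (n : ℕ) : Set (ℕ → Bool) :=
  {z | ∀ i < n, z i = x i}

/-- `C_{x,n}`, which is `U_{x,n} \ U_{x,n+1}`. -/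
def C (x : ℕ → Bool) (n : ℕ) : Set (ℕ → Bool) :=
  U x n \ U x (n + 1)

/-- The set `U_{x,n} ⊗ W`: the union of `{x} × W` and of the sets `C_{x,m} × Y` for all `m ≥ n`
such that the point `d_m`, the `m`th iterate of `η` at `d`, is in `W`. -/
def basicNhd (η : Y ≃ₜ Y) (d : Y) (x : ℕ → Bool) (n : ℕ) (W : Set Y) :
    Set (CantorResolution η d) :=
  {p | (p.1 = x ∧ p.2 ∈ W) ∨ ∃ m, n ≤ m ∧ η^[m] d ∈ W ∧ p.1 ∈ C x m}

theorem basicNhd_mono (η : Y ≃ₜ Y) (d : Y) (x : ℕ → Bool) {n n' : ℕ} (hn : n ≤ n')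
    {W W' : Set Y} (hW : W' ⊆ W) : basicNhd η d x n' W' ⊆ basicNhd η d x n W := by
  rintro p (⟨h1, h2⟩ | ⟨m, h1, h2, h3⟩)
  · exact Or.inl ⟨h1, hW h2⟩
  · exact Or.inr ⟨m, hn.trans h1, hW h2, h3⟩

/-- The topology in which the sets `U_{x,n} ⊗ W`, with `n` a natural number and `W` a
neighbourhood of `y` in `Y`, are the basic neighbourhoods of the point `(x, y)`. -/
instance (η : Y ≃ₜ Y) (d : Y) : TopologicalSpace (CantorResolution η d) where
  IsOpen O := ∀ p ∈ O, ∃ n : ℕ, ∃ W ∈ 𝓝 p.2, basicNhd η d p.1 n W ⊆ O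
  isOpen_univ := fun _ _ => ⟨0, univ, Filter.univ_mem, subset_univ _⟩
  isOpen_inter := by
    rintro O O' h h' p ⟨hp, hp'⟩
    obtain ⟨n, W, hW, hs⟩ := h p hp
    obtain ⟨n', W', hW', hs'⟩ := h' p hp'
    exact ⟨max n n', W ∩ W', Filter.inter_mem hW hW', subset_inter
      ((basicNhd_mono η d p.1 (le_max_left _ _) inter_subset_left).trans hs)
      ((basicNhd_mono η d p.1 (le_max_right _ _) inter_subset_right).trans hs')⟩
  isOpen_sUnion := by
    rintro S h p ⟨O, hO, hp⟩
    obtain ⟨n, W, hW, hs⟩ := h O hO p hp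
    exact ⟨n, W, hW, hs.trans (subset_sUnion_of_mem hO)⟩

/-- A check on the topology: the sets `U_{x,n} ⊗ W` form a neighbourhood base at `(x, y)`. -/
theorem hasBasis_nhds (η : Y ≃ₜ Y) (d : Y) (p : CantorResolution η d) :
    (𝓝 p).HasBasis (fun q : ℕ × Set Y => q.2 ∈ 𝓝 p.2)
      (fun q => basicNhd η d p.1 q.1 q.2) := by
  refine ⟨fun t => ⟨fun ht => ?_, ?_⟩⟩
  · obtain ⟨O, hOt, hO, hp⟩ := mem_nhds_iff.1 ht
    obtain ⟨n, W, hW, hs⟩ := hO p hp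
    exact ⟨(n, W), hW, hs.trans hOt⟩
  · rintro ⟨⟨n, W⟩, hW, hs⟩
    obtain ⟨V, hVW, hV, hpV⟩ := mem_nhds_iff.1 hW
    refine mem_nhds_iff.2 ⟨basicNhd η d p.1 n V,
      (basicNhd_mono η d p.1 le_rfl hVW).trans hs, ?_, Or.inl ⟨rfl, hpV⟩⟩
    rintro q (⟨h1, h2⟩ | ⟨m, h1, h2, h3⟩)
    · exact ⟨n, V, hV.mem_nhds h2, by rw [h1]⟩
    · have key : ∀ z : ℕ → Bool, (∀ i < m + 1, z i = q.1 i) → z ∈ C p.1 m := by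
        intro z hz
        refine ⟨fun i hi => (hz i (by omega)).trans (h3.1 i hi), fun h => h3.2 fun i hi => ?_⟩
        rw [← hz i hi, h i hi]
      refine ⟨m + 1, univ, Filter.univ_mem, ?_⟩
      rintro r (⟨h4, -⟩ | ⟨k, h4, -, h5⟩)
      · exact Or.inr ⟨m, h1, h2, by rw [h4]; exact h3⟩
      · exact Or.inr ⟨m, h1, h2, key _ fun i hi => h5.1 i (by omega)⟩

end CantorResolution

/-!
Write `X` for the resolution and `d_m` for the `m`th iterate of `η` at `d`. The topology of `X` is
the one given by the projection `proj` onto the Cantor set and the maps `resMap x : X → Y`, where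
`resMap x` is the identity on the fibre over `x` and maps `C_{x,m} × Y` to `d_m`
(`CantorResolution.nhds_eq`). Compactness, the Hausdorff property, zero-dimensionality and the upper
bound on the character follow directly; the lower bound holds because the fibres are copies of `Y`.
The space `Y` has no isolated points, so the points `d_m` visit every nonempty open set infinitely
often, and hence the preimages of the basic clopen sets of the Cantor set form a countable π-base.

*Homogeneity when `w(Y) < 𝔭`.* Given points in the fibres over `x` and `x'`, take an
autohomeomorphism `h` of `Y` that matches their second coordinates. Each `C_{x,m} × Y` is
homeomorphic to each `C_{x',k} × Y`: shift the first coordinate and apply `η` to the power `k - m`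
in the second. Gluing these homeomorphisms along a permutation `k = ρ m` and adding `h` between
the fibres gives a bijection `CantorResolution.graftMap` of `X`, and it is continuous as soon as
the points `d_{ρ m}` and `h d_m` cluster in the same way (`Shadows`). To find `ρ`, choose for each
`m` an infinite set `P_m` of indices `k` along which `d_k` converges to `h d_m`; it is a
pseudointersection of `w(Y)` sets. A function that dominates `w(Y)` given functions, which exists
because `𝔭` is at most the bounding number (`exists_eventually_le`), tells how far out in `P_m` to
go, and gives an injection instead of a permutation (`exists_injective_shadows`). The same for
`h⁻¹` and the Schröder–Bernstein theorem give `ρ` (`exists_perm_shadows`). Martin's axiom implies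
`𝔭 ≥ 𝔠` (`MartinsAxiom.continuum_le`), so that `ℵ₁ < 𝔭` under `MA + ¬CH`.

*Failure of homogeneity under `CH`.* An autohomeomorphism of a Hausdorff space is determined by its
action on a π-base, so a homogeneous Hausdorff space of countable π-weight has at most `2^ℵ₀` points
(`IsHomogeneousSpace.mk_le_continuum`). On the other hand no point of `Y` is a `G_δ`, since `Y` is
homogeneous of character `ℵ₁`, and a decreasing chain of `ω₁` closed `G_δ` sets shows that `Y`, and
hence `X`, has more than `ℵ₁` points (`aleph_one_lt_mk`).
-/

namespace CantorResolution

open Filter PiNat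

/-! ### The Cantor set -/

theorem isClopen_U (x : ℕ → Bool) (n : ℕ) : IsClopen (U x n) := by
  have h : U x n = ⋂ i ∈ Finset.range n, (fun z : ℕ → Bool => z i) ⁻¹' {x i} := by
    ext z
    simp [U]
  rw [h]
  exact isClopen_biInter_finset fun i _ =>
    (isClopen_discrete ({x i} : Set Bool)).preimage (continuous_apply i)

theorem mem_U_self (x : ℕ → Bool) (n : ℕ) : x ∈ U x n := fun _ _ => rfl

theorem U_anti (x : ℕ → Bool) {m n : ℕ} (h : m ≤ n) : U x n ⊆ U x m :=
  fun _ hz i hi => hz i (hi.trans_le h)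

theorem U_eq_of_mem {x z : ℕ → Bool} {n : ℕ} (h : z ∈ U x n) : U z n = U x n := by
  ext w
  exact forall₂_congr fun i hi => by rw [h i hi]

theorem isClopen_C (x : ℕ → Bool) (n : ℕ) : IsClopen (C x n) :=
  (isClopen_U x n).diff (isClopen_U x (n + 1))

theorem hasBasis_nhds_U (x : ℕ → Bool) : (𝓝 x).HasBasis (fun _ => True) (U x) := by
  refine ⟨fun t => ⟨fun ht => ?_, ?_⟩⟩
  · obtain ⟨v, ⟨z, n, rfl⟩, hx, hv⟩ :=
      (isTopologicalBasis_cylinders (fun _ => Bool)).mem_nhds_iff.1 ht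
    exact ⟨n, trivial, (U_eq_of_mem (x := z) hx).subset.trans hv⟩
  · rintro ⟨n, -, h⟩
    exact mem_of_superset ((isClopen_U x n).isOpen.mem_nhds (mem_U_self x n)) h

theorem mem_U_iff {x z : ℕ → Bool} {n : ℕ} : z ∈ U x n ↔ z = x ∨ n ≤ firstDiff z x := by
  rcases eq_or_ne z x with rfl | h
  · simp [mem_U_self]
  · exact (mem_cylinder_iff_le_firstDiff h n).trans (by simp [h])

theorem mem_C_iff {x z : ℕ → Bool} {m : ℕ} : z ∈ C x m ↔ z ≠ x ∧ firstDiff z x = m := by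
  rw [C, Set.mem_sdiff, mem_U_iff, mem_U_iff]
  rcases eq_or_ne z x with rfl | h
  · simp
  · simp only [h, false_or, ne_eq, not_false_eq_true, true_and]
    omega

theorem C_nonempty (x : ℕ → Bool) (m : ℕ) : (C x m).Nonempty := by
  refine ⟨Function.update x m (!x m), fun i hi => Function.update_of_ne hi.ne _ _, fun h => ?_⟩
  simpa using h m m.lt_succ_self

/-! ### The topology of the resolution -/

variable {Y : Type u} [TopologicalSpace Y] {η : Y ≃ₜ Y} {d : Y}

/-- The projection of the resolution onto the Cantor set. -/
def proj (p : CantorResolution η d) : ℕ → Bool := p.1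

/-- The map of the resolution onto the fibre over `x`, identified with `Y`: it is the identity on
the fibre, and it maps `C_{x,m} × Y` to the point `d_m`. -/
noncomputable def resMap (x : ℕ → Bool) (p : CantorResolution η d) : Y :=
  open scoped Classical in if p.1 = x then p.2 else η^[firstDiff p.1 x] d

theorem resMap_of_eq {x : ℕ → Bool} {p : CantorResolution η d} (h : p.1 = x) :
    resMap x p = p.2 := if_pos h

theorem resMap_of_ne {x : ℕ → Bool} {p : CantorResolution η d} (h : p.1 ≠ x) :
    resMap x p = η^[firstDiff p.1 x] d := if_neg h

theorem basicNhd_eq (x : ℕ → Bool) (n : ℕ) (W : Set Y) :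
    basicNhd η d x n W = proj ⁻¹' U x n ∩ resMap x ⁻¹' W := by
  ext p
  simp only [basicNhd, mem_ofPred_eq, mem_inter_iff, mem_preimage, mem_C_iff, mem_U_iff, proj]
  rcases eq_or_ne p.1 x with h | h
  · simp [h, resMap_of_eq h]
  · simp only [h, false_and, ne_eq, not_false_eq_true, true_and, false_or, resMap_of_ne h]
    exact ⟨fun ⟨m, h1, h2, h3⟩ => h3 ▸ ⟨h1, h2⟩, fun ⟨h1, h2⟩ => ⟨_, h1, h2, rfl⟩⟩

/-- The neighbourhoods of `(x, y)` are those given by the two maps `proj` and `resMap x`. -/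
theorem nhds_eq (p : CantorResolution η d) :
    𝓝 p = comap proj (𝓝 p.1) ⊓ comap (resMap p.1) (𝓝 p.2) := by
  refine (hasBasis_nhds η d p).eq_of_same_basis ?_
  have h := ((hasBasis_nhds_U p.1).comap (proj (η := η) (d := d))).inf
    ((basis_sets (𝓝 p.2)).comap (resMap (η := η) (d := d) p.1))
  refine h.to_hasBasis ?_ ?_
  · rintro ⟨n, W⟩ ⟨-, hW⟩
    exact ⟨(n, W), hW, (basicNhd_eq _ _ _).subset⟩
  · rintro ⟨n, W⟩ hW
    exact ⟨(n, W), ⟨trivial, hW⟩, (basicNhd_eq _ _ _).superset⟩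

theorem continuous_proj : Continuous (proj (η := η) (d := d)) :=
  continuous_iff_continuousAt.2 fun p =>
    tendsto_iff_comap.2 ((nhds_eq p).trans_le inf_le_left)

theorem continuous_resMap (x : ℕ → Bool) : Continuous (resMap (η := η) (d := d) x) := by
  refine continuous_iff_continuousAt.2 fun p => ?_
  rcases eq_or_ne p.1 x with rfl | h
  · rw [ContinuousAt, resMap_of_eq rfl]
    exact tendsto_iff_comap.2 ((nhds_eq p).trans_le inf_le_right)
  · -- away from the fibre over `x` the map is locally constant
    have hC : proj ⁻¹' C x (firstDiff p.1 x) ∈ 𝓝 p :=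
      continuous_proj.continuousAt.preimage_mem_nhds
        ((isClopen_C _ _).isOpen.mem_nhds (mem_C_iff.2 ⟨h, rfl⟩))
    refine continuousAt_const.congr (f := fun _ => η^[firstDiff p.1 x] d) ?_
    filter_upwards [hC] with q hq
    obtain ⟨h1, h2⟩ := mem_C_iff.1 hq
    rw [resMap_of_ne (p := q) h1]
    exact congrArg (fun m => η^[m] d) h2.symm

theorem continuousAt_iff {Z : Type*} [TopologicalSpace Z] {f : Z → CantorResolution η d} {z : Z} :
    ContinuousAt f z ↔ ContinuousAt (fun w => proj (f w)) z ∧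
      ContinuousAt (fun w => resMap (f z).1 (f w)) z := by
  rw [ContinuousAt, nhds_eq, tendsto_inf, tendsto_comap_iff, tendsto_comap_iff, ContinuousAt,
    ContinuousAt, resMap_of_eq rfl]
  rfl

theorem isOpen_basicNhd (x : ℕ → Bool) (n : ℕ) {W : Set Y} (hW : IsOpen W) :
    IsOpen (basicNhd η d x n W) := by
  rw [basicNhd_eq]
  exact ((isClopen_U x n).isOpen.preimage continuous_proj).inter
    (hW.preimage (continuous_resMap x))

/-- The inclusion of `Y` as the fibre over `x`. -/
def fiberMap (η : Y ≃ₜ Y) (d : Y) (x : ℕ → Bool) (y : Y) : CantorResolution η d := (x, y)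

theorem continuous_fiberMap (x : ℕ → Bool) : Continuous (fiberMap η d x) :=
  continuous_iff_continuousAt.2 fun _ => continuousAt_iff.2
    ⟨continuousAt_const, continuousAt_id.congr (.of_forall fun y =>
      (resMap_of_eq (p := fiberMap η d x y) rfl).symm)⟩

instance compactSpace [CompactSpace Y] : CompactSpace (CantorResolution η d) := by
  refine ⟨isCompact_iff_ultrafilter_le_nhds.2 fun F _ => ?_⟩
  obtain ⟨x, -, hx⟩ := isCompact_univ.ultrafilter_le_nhds (F.map proj) (by simp)
  obtain ⟨y, -, hy⟩ := isCompact_univ.ultrafilter_le_nhds (F.map (resMap x)) (by simp)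
  refine ⟨fiberMap η d x y, trivial, ?_⟩
  rw [nhds_eq]
  exact le_inf (map_le_iff_le_comap.1 hx) (map_le_iff_le_comap.1 hy)

instance t2Space [T2Space Y] : T2Space (CantorResolution η d) := by
  refine ⟨fun p q hpq => ?_⟩
  rcases eq_or_ne p.1 q.1 with h | h
  · have h2 : resMap p.1 p ≠ resMap p.1 q := by
      rw [resMap_of_eq rfl, resMap_of_eq h.symm]
      exact fun h' => hpq (Prod.ext h h')
    exact separated_by_continuous (continuous_resMap p.1) h2
  · exact separated_by_continuous continuous_proj h

theorem isZeroDimensional (hY : IsZeroDimensional Y) :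
    IsZeroDimensional (CantorResolution η d) := by
  refine TopologicalSpace.isTopologicalBasis_of_isOpen_of_nhds (fun s hs => hs.isOpen)
    fun p O hp hO => ?_
  obtain ⟨⟨n, W⟩, hW, hs⟩ := (hasBasis_nhds η d p).mem_iff.1 (hO.mem_nhds hp)
  obtain ⟨V, hV, hpV, hVW⟩ := hY.mem_nhds_iff.1 hW
  refine ⟨basicNhd η d p.1 n V, ?_, Or.inl ⟨rfl, hpV⟩, (basicNhd_mono η d p.1 le_rfl hVW).trans hs⟩
  rw [mem_ofPred_eq, basicNhd_eq]
  exact ((isClopen_U _ _).preimage continuous_proj).inter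
    (IsClopen.preimage hV (continuous_resMap _))

end CantorResolution

/-! ### Cardinal functions -/

section CardinalFunctions

open Filter Cardinal

variable {X : Type u} [TopologicalSpace X]

theorem isLocalBase_setOf_isOpen (x : X) : IsLocalBase x {V | IsOpen V ∧ x ∈ V} :=
  ⟨fun _ hV => hV, fun O hO hx => ⟨O, ⟨hO, hx⟩, Subset.rfl⟩⟩

theorem exists_isLocalBase_mk_eq (x : X) : ∃ B, IsLocalBase x B ∧ #B = pointCharacter x :=
  csInf_mem (s := {κ | ∃ B : Set (Set X), IsLocalBase x B ∧ #B = κ})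
    ⟨_, _, isLocalBase_setOf_isOpen x, rfl⟩

theorem IsLocalBase.pointCharacter_le {x : X} {B : Set (Set X)} (hB : IsLocalBase x B) :
    pointCharacter x ≤ #B :=
  csInf_le' ⟨B, hB, rfl⟩

theorem pointCharacter_le_topCharacter (x : X) : pointCharacter x ≤ topCharacter X :=
  le_ciSup Cardinal.bddAbove_of_small x

theorem exists_isTopologicalBasis_mk_eq (X : Type u) [TopologicalSpace X] :
    ∃ B : Set (Set X), TopologicalSpace.IsTopologicalBasis B ∧ #B = topWeight X :=
  csInf_mem (s := {κ | ∃ B : Set (Set X), TopologicalSpace.IsTopologicalBasis B ∧ #B = κ})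
    ⟨_, _, TopologicalSpace.isTopologicalBasis_opens, rfl⟩

theorem Topology.IsInducing.pointCharacter_le {Z : Type u} [TopologicalSpace Z] {f : X → Z}
    (hf : IsInducing f) (x : X) : pointCharacter x ≤ pointCharacter (f x) := by
  obtain ⟨B, hB, hc⟩ := exists_isLocalBase_mk_eq (f x)
  rw [← hc]
  refine le_trans (IsLocalBase.pointCharacter_le (B := (f ⁻¹' ·) '' B) ⟨?_, fun O hO hx => ?_⟩)
    mk_image_le
  · rintro _ ⟨V, hV, rfl⟩
    exact ⟨(hB.1 V hV).1.preimage hf.continuous, (hB.1 V hV).2⟩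
  · obtain ⟨O', hO', rfl⟩ := hf.isOpen_iff.1 hO
    obtain ⟨V, hV, hs⟩ := hB.2 O' hO' hx
    exact ⟨_, mem_image_of_mem _ hV, preimage_mono hs⟩

theorem IsHomogeneousSpace.pointCharacter_eq (h : IsHomogeneousSpace X) (x : X) :
    pointCharacter x = topCharacter X := by
  refine le_antisymm (pointCharacter_le_topCharacter x) (ciSup_le' fun y => ?_)
  obtain ⟨g, rfl⟩ := h y x
  exact g.isInducing.pointCharacter_le y

theorem infinite_of_topWeight_eq (h : topWeight X = ℵ_ 1) : Infinite X := by
  by_contra hX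
  have := not_infinite_iff_finite.1 hX
  obtain ⟨B, -, hB⟩ := exists_isTopologicalBasis_mk_eq X
  have h1 := aleph0_lt_aleph_one.trans_eq (h.symm.trans hB.symm)
  exact (Cardinal.lt_aleph0_of_finite B).not_gt h1

/-- An infinite homogeneous compact space has no isolated points. -/
theorem IsHomogeneousSpace.neBot_nhdsNE [CompactSpace X] [Infinite X] (h : IsHomogeneousSpace X)
    (x : X) : (𝓝[≠] x).NeBot := by
  by_contra hx
  rw [not_neBot, ← isOpen_singleton_iff_punctured_nhds] at hx
  have : DiscreteTopology X := discreteTopology_iff_isOpen_singleton.2 fun y => by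
    obtain ⟨g, rfl⟩ := h x y
    rw [← image_singleton]
    exact g.isOpenMap _ hx
  exact not_finite_iff_infinite.2 ‹_› (finite_of_compact_of_discrete (X := X))

/-- In a space without isolated points a dense sequence visits each nonempty open set infinitely
often. -/
theorem infinite_setOf_mem_of_denseRange [T1Space X] [∀ x : X, (𝓝[≠] x).NeBot] {e : ℕ → X}
    (he : DenseRange e) {W : Set X} (hW : IsOpen W) (hne : W.Nonempty) :
    {m | e m ∈ W}.Infinite := by
  intro hfin
  obtain ⟨x, hx, ⟨m, rfl⟩, hm⟩ := (he.sdiff_finite (hfin.image e)).inter_open_nonempty W hW hne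
  exact hm ⟨m, hx, rfl⟩

end CardinalFunctions

namespace CantorResolution

open Filter Cardinal

variable {Y : Type u} [TopologicalSpace Y] {η : Y ≃ₜ Y} {d : Y}

theorem pointCharacter_le (p : CantorResolution η d) :
    pointCharacter p ≤ ℵ₀ * pointCharacter (X := Y) p.2 := by
  obtain ⟨B, hB, hc⟩ := exists_isLocalBase_mk_eq (X := Y) p.2
  have hlb : IsLocalBase p (range fun q : ℕ × B => basicNhd η d p.1 q.1 q.2.1) := by
    refine ⟨?_, fun O hO hp => ?_⟩
    · rintro _ ⟨⟨n, V, hV⟩, rfl⟩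
      exact ⟨isOpen_basicNhd _ _ (hB.1 V hV).1, Or.inl ⟨rfl, (hB.1 V hV).2⟩⟩
    · obtain ⟨⟨n, W⟩, hW, hs⟩ := (hasBasis_nhds η d p).mem_iff.1 (hO.mem_nhds hp)
      obtain ⟨W', hWW', hW', hpW⟩ := mem_nhds_iff.1 hW
      obtain ⟨V, hV, hVW⟩ := hB.2 W' hW' hpW
      exact ⟨_, ⟨(n, ⟨V, hV⟩), rfl⟩, (basicNhd_mono η d p.1 le_rfl (hVW.trans hWW')).trans hs⟩
  refine hlb.pointCharacter_le.trans (mk_range_le.trans ?_)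
  rw [← hc]
  simp

theorem topCharacter_eq [CompactSpace Y] [T2Space Y] (h : ℵ₀ ≤ topCharacter Y) :
    topCharacter (CantorResolution η d) = topCharacter Y := by
  apply le_antisymm
  · refine ciSup_le' fun p => (pointCharacter_le p).trans ?_
    exact (mul_le_mul' h (pointCharacter_le_topCharacter _)).trans_eq (mul_eq_self h)
  · refine ciSup_le' fun y => ?_
    have hemb : IsClosedEmbedding (fiberMap η d fun _ => false) :=
      (continuous_fiberMap _).isClosedEmbedding fun y z hyz => congrArg Prod.snd hyz
    exact (hemb.isInducing.pointCharacter_le y).trans (pointCharacter_le_topCharacter _)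

/-- The sets `U_{x,n} × Y` form a π-base: there are countably many of them, and a basic
neighbourhood contains a set `C_{x,m} × Y`, because the orbit of `d` returns to any nonempty open
set. -/
theorem isPiBase_preimage_U (hd : ∀ W : Set Y, IsOpen W → W.Nonempty →
    {m | η^[m] d ∈ W}.Infinite) :
    IsPiBase {s : Set (CantorResolution η d) | ∃ x n, s = proj ⁻¹' U x n} := by
  refine ⟨?_, fun O hO ⟨p, hp⟩ => ?_⟩
  · rintro _ ⟨x, n, rfl⟩
    exact ⟨(isClopen_U x n).isOpen.preimage continuous_proj, fiberMap η d x d, mem_U_self x n⟩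
  · obtain ⟨⟨n, W⟩, hW, hs⟩ := (hasBasis_nhds η d p).mem_iff.1 (hO.mem_nhds hp)
    obtain ⟨V, hVW, hV, hpV⟩ := mem_nhds_iff.1 hW
    obtain ⟨m, hm, hnm⟩ := (hd V hV ⟨_, hpV⟩).exists_gt n
    obtain ⟨z, hz⟩ := C_nonempty p.1 m
    obtain ⟨k, -, hk⟩ := (hasBasis_nhds_U z).mem_iff.1 ((isClopen_C p.1 m).isOpen.mem_nhds hz)
    exact ⟨_, ⟨z, k, rfl⟩, fun q hq => hs (Or.inr ⟨m, hnm.le, hVW hm, hk hq⟩)⟩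

theorem countable_setOf_preimage_U :
    {s : Set (CantorResolution η d) | ∃ x n, s = proj ⁻¹' U x n}.Countable := by
  -- a cylinder is determined by its length and by finitely many coordinates
  let f : (Σ n : ℕ, Fin n → Bool) → Set (CantorResolution η d) := fun a =>
    proj ⁻¹' {z | ∀ i : Fin a.1, z i = a.2 i}
  refine (countable_range f).mono ?_
  rintro _ ⟨x, n, rfl⟩
  refine ⟨⟨n, fun i => x i⟩, ?_⟩
  ext p
  exact ⟨fun h i hi => h ⟨i, hi⟩, fun h i => h i i.2⟩

theorem piWeight_eq (hd : ∀ W : Set Y, IsOpen W → W.Nonempty → {m | η^[m] d ∈ W}.Infinite) :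
    piWeight (CantorResolution η d) = ℵ₀ := by
  apply le_antisymm
  · exact le_trans (csInf_le' ⟨_, isPiBase_preimage_U hd, rfl⟩)
      (le_aleph0_iff_set_countable.2 countable_setOf_preimage_U)
  · refine le_csInf ⟨_, _, isPiBase_preimage_U hd, rfl⟩ ?_
    rintro _ ⟨B, hB, rfl⟩
    -- the sets `C_{x,n} × Y` are disjoint, so they contain distinct members of a π-base
    have key : ∀ n, ∃ V ∈ B, V ⊆ proj ⁻¹' C (fun _ => false) n := fun n =>
      hB.2 _ ((isClopen_C _ n).isOpen.preimage continuous_proj)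
        (let ⟨z, hz⟩ := C_nonempty _ n; ⟨fiberMap η d z d, hz⟩)
    choose V hV hVC using key
    rw [infinite_iff.symm]
    refine Infinite.of_injective (fun n => (⟨V n, hV n⟩ : B)) fun m n hmn => ?_
    have h : V m = V n := congrArg Subtype.val hmn
    obtain ⟨p, hp⟩ := (hB.1 _ (hV m)).2
    exact (mem_C_iff.1 (hVC m hp)).2.symm.trans (mem_C_iff.1 (hVC n (h ▸ hp))).2

end CantorResolution

/-! ### Shadowing sequences -/

section Shadowing

open Filter

variable {Y : Type u} [TopologicalSpace Y]

/-- The sequence `f` shadows `e`: it converges to each limit of `e` along a nonprincipal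
ultrafilter. In a compact Hausdorff space this says that `f n` gets uniformly close to `e n`. -/
def Shadows (e f : ℕ → Y) : Prop :=
  ∀ F : Ultrafilter ℕ, ↑F ≤ (cofinite : Filter ℕ) → ∀ z, Tendsto e F (𝓝 z) → Tendsto f F (𝓝 z)

theorem Shadows.symm [CompactSpace Y] [T2Space Y] {e f : ℕ → Y} (h : Shadows e f) :
    Shadows f e := by
  intro F hF z hz
  obtain ⟨y, -, hy⟩ := isCompact_univ.ultrafilter_le_nhds (F.map e) (by simp)
  rwa [tendsto_nhds_unique hz (h F hF y hy)]

end Shadowing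

namespace CantorResolution

open Filter PiNat

/-! ### Grafting: homeomorphisms between fibres that extend to the resolution -/

/-- The member of `C_{x,k}` whose tail after the `k`th coordinate is the tail of `z` after the
`m`th coordinate. -/
def graft (x : ℕ → Bool) (k m : ℕ) (z : ℕ → Bool) : ℕ → Bool := fun i =>
  if i < k then x i else if i = k then !x k else z (i - k + m)

theorem graft_mem_C (x : ℕ → Bool) (k m : ℕ) (z : ℕ → Bool) : graft x k m z ∈ C x k := by
  refine ⟨fun i hi => if_pos hi, fun h => ?_⟩
  have := h k k.lt_succ_self
  simp [graft] at this

theorem iterate_symm_iterate {Y : Type*} [TopologicalSpace Y] (η : Y ≃ₜ Y) (k : ℕ) (y : Y) :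
    η.symm^[k] (η^[k] y) = y :=
  Function.LeftInverse.iterate η.symm_apply_apply k y

theorem iterate_iterate_symm {Y : Type*} [TopologicalSpace Y] (η : Y ≃ₜ Y) (k : ℕ) (y : Y) :
    η^[k] (η.symm^[k] y) = y :=
  Function.LeftInverse.iterate η.apply_symm_apply k y

theorem continuous_graft (x : ℕ → Bool) (k m : ℕ) : Continuous (graft x k m) := by
  refine continuous_pi fun i => ?_
  unfold graft
  split_ifs
  · exact continuous_const
  · exact continuous_const
  · exact continuous_apply _

theorem apply_eq_not_of_mem_C {x z : ℕ → Bool} {m : ℕ} (h : z ∈ C x m) : z m = !x m := by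
  obtain ⟨h1, h2⟩ := mem_C_iff.1 h
  exact Bool.eq_not.2 (h2 ▸ apply_firstDiff_ne h1)

theorem graft_graft {x x' z : ℕ → Bool} {m : ℕ} (k : ℕ) (h : z ∈ C x m) :
    graft x m k (graft x' k m z) = z := by
  funext i
  rcases lt_trichotomy i m with hi | rfl | hi
  · simpa [graft, hi] using (h.1 i hi).symm
  · simpa [graft] using (apply_eq_not_of_mem_C h).symm
  · have h1 : ¬ i < m := by omega
    have h2 : i - m + k - k + m = i := by omega
    have h3 : ¬ i - m + k < k := by omega
    have h4 : ¬ i - m + k = k := by omega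
    simp only [graft, if_neg h1, if_neg hi.ne', if_neg h3, if_neg h4, h2]

/-- Grafting shifts the first index of difference of two members of `C_{x,m}` by `k - m`. -/
theorem exists_graft_mem_C {x x' z w : ℕ → Bool} {m k : ℕ} (hz : z ∈ C x m) (hw : w ∈ C x m)
    (hwz : w ≠ z) : ∃ j, firstDiff w z = j + m ∧ graft x' k m w ∈ C (graft x' k m z) (j + k) := by
  have hlt : m < firstDiff w z := by
    by_contra! hle
    refine apply_firstDiff_ne hwz ?_
    rcases hle.lt_or_eq with h | h
    · rw [hw.1 _ h, hz.1 _ h]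
    · rw [h, apply_eq_not_of_mem_C hw, apply_eq_not_of_mem_C hz]
  refine ⟨firstDiff w z - m, by omega, fun i hi => ?_, fun h => ?_⟩
  · unfold graft
    split_ifs
    · rfl
    · rfl
    · exact apply_eq_of_lt_firstDiff (by omega)
  · refine apply_firstDiff_ne hwz ?_
    have h1 := h (firstDiff w z - m + k) (by omega)
    have h2 : firstDiff w z - m + k - k + m = firstDiff w z := by omega
    have h3 : ¬ firstDiff w z - m + k < k := by omega
    have h4 : ¬ firstDiff w z - m + k = k := by omega
    simpa only [graft, if_neg h3, if_neg h4, h2] using h1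

variable {Y : Type u} [TopologicalSpace Y] {η : Y ≃ₜ Y} {d : Y}

/-- The map that acts as `h` from the fibre over `x` to the fibre over `x'`, and that maps
`C_{x,m} × Y` onto `C_{x',ρ m} × Y` by grafting in the first coordinate and by `η` to the power
`ρ m - m` in the second. -/
noncomputable def graftMap (x x' : ℕ → Bool) (ρ : ℕ → ℕ) (h : Y → Y) (p : CantorResolution η d) :
    CantorResolution η d :=
  open scoped Classical in
  if p.1 = x then fiberMap η d x' (h p.2) else
    fiberMap η d (graft x' (ρ (firstDiff p.1 x)) (firstDiff p.1 x) p.1)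
      (η^[ρ (firstDiff p.1 x)] (η.symm^[firstDiff p.1 x] p.2))

theorem graftMap_of_eq {x x' : ℕ → Bool} {ρ : ℕ → ℕ} {h : Y → Y} {p : CantorResolution η d}
    (hp : p.1 = x) : graftMap x x' ρ h p = fiberMap η d x' (h p.2) := if_pos hp

theorem graftMap_of_mem_C {x x' : ℕ → Bool} {ρ : ℕ → ℕ} {h : Y → Y} {p : CantorResolution η d}
    {m : ℕ} (hp : p.1 ∈ C x m) : graftMap x x' ρ h p =
      fiberMap η d (graft x' (ρ m) m p.1) (η^[ρ m] (η.symm^[m] p.2)) := by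
  obtain ⟨h1, rfl⟩ := mem_C_iff.1 hp
  exact if_neg h1

theorem graftMap_graftMap (x x' : ℕ → Bool) {ρ ρ' : ℕ → ℕ} {h h' : Y → Y}
    (hρ : Function.LeftInverse ρ' ρ) (hh : Function.LeftInverse h' h) (p : CantorResolution η d) :
    graftMap x' x ρ' h' (graftMap x x' ρ h p) = p := by
  rcases eq_or_ne p.1 x with hp | hp
  · rw [graftMap_of_eq hp]
    exact (graftMap_of_eq (p := fiberMap η d x' (h p.2)) rfl).trans
      (Prod.ext hp.symm (hh p.2))
  · have hC : p.1 ∈ C x (firstDiff p.1 x) := mem_C_iff.2 ⟨hp, rfl⟩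
    rw [graftMap_of_mem_C hC,
      graftMap_of_mem_C (p := fiberMap η d (graft x' _ _ p.1) _) (graft_mem_C x' _ _ _), hρ]
    have h1 (m k : ℕ) (y : Y) : η^[m] (η.symm^[k] (η^[k] (η.symm^[m] y))) = y := by
      rw [iterate_symm_iterate, iterate_iterate_symm]
    exact Prod.ext (graft_graft _ hC) (h1 _ _ _)

theorem continuousAt_graftMap_of_ne {x x' : ℕ → Bool} {ρ : ℕ → ℕ} {h : Y → Y}
    {p : CantorResolution η d} (hp : p.1 ≠ x) : ContinuousAt (graftMap x x' ρ h) p := by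
  have hC : p.1 ∈ C x (firstDiff p.1 x) := mem_C_iff.2 ⟨hp, rfl⟩
  generalize firstDiff p.1 x = m at hC
  have hev : ∀ᶠ q : CantorResolution η d in 𝓝 p, q.1 ∈ C x m :=
    continuous_proj.continuousAt.preimage_mem_nhds ((isClopen_C x m).isOpen.mem_nhds hC)
  rw [continuousAt_iff]
  constructor
  · refine ((continuous_graft x' (ρ m) m).comp continuous_proj).continuousAt.congr ?_
    filter_upwards [hev] with q hq
    rw [graftMap_of_mem_C hq]
    rfl
  · have hcont : Continuous fun q : CantorResolution η d =>
        η^[ρ m] (η.symm^[m] (resMap p.1 q)) :=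
      (η.continuous.iterate _).comp ((η.symm.continuous.iterate _).comp (continuous_resMap p.1))
    refine hcont.continuousAt.congr ?_
    filter_upwards [hev] with q hq
    rw [graftMap_of_mem_C hq, graftMap_of_mem_C hC]
    rcases eq_or_ne q.1 p.1 with hqp | hqp
    · rw [resMap_of_eq hqp]
      exact (resMap_of_eq (p := fiberMap η d (graft x' (ρ m) m q.1) _)
        (congrArg (graft x' (ρ m) m) hqp)).symm
    · obtain ⟨j, hj, hg⟩ := exists_graft_mem_C (x' := x') (k := ρ m) hC hq hqp
      obtain ⟨h1, h2⟩ := mem_C_iff.1 hg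
      rw [resMap_of_ne hqp, hj]
      refine Eq.trans ?_ (resMap_of_ne (p := fiberMap η d (graft x' (ρ m) m q.1) _) h1).symm
      refine Eq.trans ?_ (congrArg (fun i => η^[i] d) h2.symm)
      simp only [add_comm j, Function.iterate_add_apply, iterate_symm_iterate]

/-- On the fibre over `x` continuity of `graftMap` means that `h` and `ρ` match: the points
`d_{ρ m}` shadow the points `h d_m`. -/
theorem continuousAt_graftMap_of_eq {x x' : ℕ → Bool} {ρ : ℕ → ℕ} {h : Y → Y}
    (hρ : Function.Injective ρ) (hh : Continuous h)
    (hs : Shadows (fun m => h (η^[m] d)) fun m => η^[ρ m] d) {p : CantorResolution η d}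
    (hp : p.1 = x) : ContinuousAt (graftMap x x' ρ h) p := by
  rw [continuousAt_iff_ultrafilter]
  intro G hG
  rw [graftMap_of_eq hp]
  by_cases hx : {q : CantorResolution η d | q.1 = x} ∈ G
  · have h1 : Tendsto (fun q => fiberMap η d x' (h (resMap x q))) G
        (𝓝 (fiberMap η d x' (h (resMap x p)))) :=
      (((continuous_fiberMap x').comp (hh.comp (continuous_resMap x))).tendsto p).mono_left hG
    rw [resMap_of_eq hp] at h1
    refine h1.congr' ?_
    filter_upwards [hx] with q hq
    rw [graftMap_of_eq hq, resMap_of_eq hq]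
  · replace hx : ∀ᶠ q : CantorResolution η d in G, q.1 ≠ x :=
      Ultrafilter.eventually_not.2 hx
    let L : CantorResolution η d → ℕ := fun q => firstDiff q.1 x
    have hL : Tendsto L G atTop := tendsto_atTop.2 fun n => by
      have h1 : ∀ᶠ q : CantorResolution η d in G, q.1 ∈ U x n :=
        hG (continuous_proj.continuousAt.preimage_mem_nhds
          ((isClopen_U x n).isOpen.mem_nhds (by rw [proj, hp]; exact mem_U_self x n)))
      filter_upwards [h1, hx] with q hq hne
      exact (mem_U_iff.1 hq).resolve_left hne
    have hρL : Tendsto (fun q => ρ (L q)) G atTop := by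
      rw [← Nat.cofinite_eq_atTop] at hL ⊢
      exact hρ.tendsto_cofinite.comp hL
    have hC : ∀ᶠ q : CantorResolution η d in G, (graftMap x x' ρ h q).1 ∈ C x' (ρ (L q)) := by
      filter_upwards [hx] with q hq
      rw [graftMap_of_mem_C (mem_C_iff.2 ⟨hq, rfl⟩)]
      exact graft_mem_C _ _ _ _
    rw [nhds_eq, tendsto_inf, tendsto_comap_iff, tendsto_comap_iff]
    constructor
    · refine (hasBasis_nhds_U _).tendsto_right_iff.2 fun n _ => ?_
      filter_upwards [hC, hρL.eventually_ge_atTop n] with q hq hn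
      exact U_anti x' hn hq.1
    · have h1 : Tendsto (fun q => h (η^[L q] d)) G (𝓝 (h p.2)) := by
        have h2 : Tendsto (fun q => h (resMap x q)) G (𝓝 (h (resMap x p))) :=
          ((hh.comp (continuous_resMap x)).tendsto p).mono_left hG
        rw [resMap_of_eq hp] at h2
        refine h2.congr' ?_
        filter_upwards [hx] with q hq
        rw [resMap_of_ne hq]
      have h3 : Tendsto (fun q => η^[ρ (L q)] d) G (𝓝 (h p.2)) :=
        hs (G.map L) (by rw [Nat.cofinite_eq_atTop]; exact hL) (h p.2) h1
      refine h3.congr' ?_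
      filter_upwards [hC] with q hq
      obtain ⟨h4, h5⟩ := mem_C_iff.1 hq
      exact ((resMap_of_ne h4).trans (congrArg (fun m => η^[m] d) h5)).symm

/-- If every autohomeomorphism of `Y` can be matched with a permutation of the orbit of `d`, then
the resolution inherits homogeneity from `Y`. -/
theorem isHomogeneousSpace_of_forall_shadows [CompactSpace Y] [T2Space Y]
    (hhom : IsHomogeneousSpace Y)
    (H : ∀ h : Y ≃ₜ Y, ∃ ρ : Equiv.Perm ℕ, Shadows (fun m => h (η^[m] d)) fun m => η^[ρ m] d) :
    IsHomogeneousSpace (CantorResolution η d) := by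
  intro p q
  obtain ⟨h, hpq⟩ := hhom p.2 q.2
  obtain ⟨ρ, hρ⟩ := H h
  let e : CantorResolution η d ≃ CantorResolution η d :=
    { toFun := graftMap p.1 q.1 ρ h
      invFun := graftMap q.1 p.1 ρ.symm h.symm
      left_inv := graftMap_graftMap _ _ ρ.left_inv h.left_inv
      right_inv := graftMap_graftMap _ _ ρ.right_inv h.right_inv }
  have he : Continuous e := continuous_iff_continuousAt.2 fun r => by
    rcases eq_or_ne r.1 p.1 with hr | hr
    · exact continuousAt_graftMap_of_eq ρ.injective h.continuous hρ hr
    · exact continuousAt_graftMap_of_ne hr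
  refine ⟨he.homeoOfEquivCompactToT2, ?_⟩
  change graftMap p.1 q.1 ρ h p = q
  rw [graftMap_of_eq rfl, hpq]
  rfl

end CantorResolution

/-! ### Pseudointersections -/

section Pseudointersection

open Filter Cardinal

theorem infinite_of_mem_of_le_cofinite {α : Type*} {𝓕 : Filter α} [𝓕.NeBot] (h : 𝓕 ≤ cofinite)
    {s : Set α} (hs : s ∈ 𝓕) : s.Infinite :=
  frequently_cofinite_iff_infinite.1 ((show ∀ᶠ a in 𝓕, a ∈ s from hs).frequently.filter_mono h)

/-- Fewer than `𝔭` members of a filter of infinite sets on a countable set have an infinite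
pseudointersection. -/
theorem exists_pseudointersection {ι : Type u} {α : Type} [Denumerable α]
    (hι : #ι < lift.{u} pseudointersectionNumber) {𝓕 : Filter α} [𝓕.NeBot] (h : 𝓕 ≤ cofinite)
    {S : ι → Set α} (hS : ∀ i, S i ∈ 𝓕) : ∃ A : Set α, A.Infinite ∧ ∀ i, (A \ S i).Finite := by
  let e : α ≃ ℕ := Denumerable.eqv α
  by_contra hA
  have h1 : pseudointersectionNumber ≤ #(range fun i => e '' S i) := by
    refine csInf_le' ⟨_, fun T hT hfin => ?_, ?_, rfl⟩
    · have h2 : ⋂₀ T ∈ 𝓕.map e := (sInter_mem hfin).2 fun B hB => by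
        obtain ⟨i, rfl⟩ := hT hB
        exact image_mem_map (hS i)
      exact infinite_of_mem_of_le_cofinite ((map_mono h).trans e.injective.tendsto_cofinite) h2
    · rintro ⟨A, hinf, hfin⟩
      refine hA ⟨e.symm '' A, hinf.image e.symm.injective.injOn, fun i => ?_⟩
      refine ((hfin _ ⟨i, rfl⟩).image e.symm).subset ?_
      rintro _ ⟨⟨n, hn, rfl⟩, h3⟩
      refine ⟨n, ⟨hn, ?_⟩, rfl⟩
      rintro ⟨a, ha, rfl⟩
      exact h3 (by simpa using ha)
  have h2 := mk_range_le_lift (f := fun i => e '' S i)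
  rw [lift_uzero] at h2
  exact ((lift_le.2 h1).trans h2).not_gt hι

/-- Fewer than `𝔭` functions on the natural numbers are eventually dominated by a single one. -/
theorem exists_eventually_le {ι : Type u} (hinf : ℵ₀ ≤ #ι)
    (hι : #ι < lift.{u} pseudointersectionNumber) (g : ι → ℕ → ℕ) :
    ∃ f : ℕ → ℕ, ∀ i, ∃ N, ∀ n ≥ N, g i n ≤ f n := by
  -- a pseudointersection of the sets above the graphs and of the sets `[n, ∞) × ℕ` is, on
  -- infinitely many columns, a dominating function; passing to monotone functions makes it
  -- dominating everywhere
  let g' : ι → ℕ →o ℕ := fun i => partialSups (g i)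
  let S : ι ⊕ ℕ → Set (ℕ × ℕ) := Sum.elim (fun i => {a | g' i a.1 ≤ a.2}) fun n => {a | n ≤ a.1}
  have hcard : #(ι ⊕ ℕ) < lift.{u} pseudointersectionNumber := by
    rwa [mk_sum, lift_uzero, mk_nat, lift_aleph0, add_eq_left hinf hinf]
  have hle : (atTop.curry atTop : Filter (ℕ × ℕ)) ≤ cofinite := by
    refine le_cofinite_iff_eventually_ne.2 fun a => Filter.eventually_curry_iff.2 ?_
    filter_upwards [eventually_gt_atTop a.1] with m hm
    exact .of_forall fun k hk => hm.ne' (congrArg Prod.fst hk)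
  have hne : (atTop.curry atTop : Filter (ℕ × ℕ)).NeBot := by
    refine ⟨fun hbot => ?_⟩
    have h1 : ∀ᶠ a in (atTop.curry atTop : Filter (ℕ × ℕ)), False := by rw [hbot]; trivial
    obtain ⟨m, hm⟩ := (Filter.eventually_curry_iff.1 h1).exists
    exact hm.exists.elim fun _ => id
  have hS : ∀ j, S j ∈ (atTop.curry atTop : Filter (ℕ × ℕ)) := by
    rintro (i | n)
    · exact Filter.eventually_curry_iff.2 (.of_forall fun m => eventually_ge_atTop (g' i m))
    · refine Filter.eventually_curry_iff.2 ?_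
      filter_upwards [eventually_ge_atTop n] with m hm
      exact .of_forall fun _ => hm
  obtain ⟨A, hA, hfin⟩ := exists_pseudointersection hcard hle hS
  have hcol : ∀ n, ∃ a ∈ A, n ≤ a.1 := fun n => by
    obtain ⟨a, ha, hna⟩ := (hA.sdiff (hfin (Sum.inr n))).nonempty
    exact ⟨a, ha, by_contra fun h => hna ⟨ha, h⟩⟩
  choose a haA ha using hcol
  refine ⟨fun n => (a n).2, fun i => ?_⟩
  obtain ⟨N, hN⟩ := ((hfin (Sum.inl i)).image Prod.fst).bddAbove
  refine ⟨N + 1, fun n hn => ?_⟩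
  have h1 : g' i (a n).1 ≤ (a n).2 := by
    by_contra h2
    have h3 := hN ⟨a n, ⟨haA n, h2⟩, rfl⟩
    have := ha n
    omega
  exact ((le_partialSups (g i) n).trans ((g' i).monotone (ha n))).trans h1

variable {Y : Type u} [TopologicalSpace Y]

/-- In a space of weight less than `𝔭` every sequence is shadowed by a rearranged subsequence of
a sequence that visits every nonempty open set infinitely often. -/
theorem exists_injective_shadows (hinf : ℵ₀ ≤ topWeight Y)
    (hw : topWeight Y < lift.{u} pseudointersectionNumber) {d : ℕ → Y}
    (hd : ∀ W : Set Y, IsOpen W → W.Nonempty → {m | d m ∈ W}.Infinite) (e : ℕ → Y) :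
    ∃ f : ℕ → ℕ, Function.Injective f ∧ Shadows e fun m => d (f m) := by
  obtain ⟨B, hB, hc⟩ := exists_isTopologicalBasis_mk_eq Y
  rw [← hc] at hw hinf
  -- the infinite set `P m` converges to `e m`
  have hP (m : ℕ) : ∃ P : Set ℕ, P.Infinite ∧
      ∀ W : B, (P \ {k | e m ∈ W.1 → d k ∈ W.1}).Finite := by
    have hne : (comap d (𝓝 (e m)) ⊓ cofinite).NeBot := by
      refine (((nhds_basis_opens (e m)).comap d).inf_neBot_iff).2 fun {W} hW s hs => ?_
      obtain ⟨k, hk, hks⟩ := ((hd W hW.2 ⟨_, hW.1⟩).sdiff hs).nonempty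
      exact ⟨k, hk, by simpa using hks⟩
    refine exists_pseudointersection hw (inf_le_right : comap d (𝓝 (e m)) ⊓ cofinite ≤ _)
      fun W => ?_
    by_cases h : e m ∈ W.1
    · filter_upwards [mem_inf_of_left
        (preimage_mem_comap ((hB.isOpen W.2).mem_nhds h))] with k hk _ using hk
    · exact univ_mem' fun k hk => absurd hk h
  choose P hPinf hPfin using hP
  choose g hg using fun (W : B) m => (hPfin m W).bddAbove
  obtain ⟨G, hG⟩ := exists_eventually_le hinf hw g
  choose nx hnx hlt using fun m n => (hPinf m).exists_gt (max (G m) n)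
  let f : ℕ → ℕ := fun m => Nat.rec (nx 0 0) (fun m prev => nx (m + 1) prev) m
  have hf : ∀ m, f m ∈ P m ∧ G m < f m := by
    rintro (_ | m)
    · exact ⟨hnx _ _, (le_max_left _ _).trans_lt (hlt _ _)⟩
    · exact ⟨hnx _ _, (le_max_left _ _).trans_lt (hlt _ _)⟩
  have hmono : StrictMono f :=
    strictMono_nat_of_lt_succ fun m => (le_max_right _ _).trans_lt (hlt (m + 1) (f m))
  refine ⟨f, hmono.injective, fun F hF z hz => hB.nhds_hasBasis.tendsto_right_iff.2 ?_⟩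
  rintro W ⟨hW, hzW⟩
  obtain ⟨N, hN⟩ := hG ⟨W, hW⟩
  have hge : ∀ᶠ m in F, N ≤ m :=
    (hF.trans_eq Nat.cofinite_eq_atTop) (eventually_ge_atTop N)
  filter_upwards [hge, hz.eventually_mem ((hB.isOpen hW).mem_nhds hzW)] with m hm hmW
  by_contra hnot
  have h1 := hg ⟨W, hW⟩ m ⟨(hf m).1, fun h => hnot (h hmW)⟩
  have h2 := hN m hm
  have h3 := (hf m).2
  omega

/-- A homeomorphism acts, up to shadowing, as a permutation on a sequence that visits every
nonempty open set infinitely often: apply the Schröder–Bernstein theorem to the rearranged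
subsequences that shadow its image and its inverse image. -/
theorem exists_perm_shadows [CompactSpace Y] [T2Space Y] (hinf : ℵ₀ ≤ topWeight Y)
    (hw : topWeight Y < lift.{u} pseudointersectionNumber) {d : ℕ → Y}
    (hd : ∀ W : Set Y, IsOpen W → W.Nonempty → {m | d m ∈ W}.Infinite) (h : Y ≃ₜ Y) :
    ∃ ρ : Equiv.Perm ℕ, Shadows (fun m => h (d m)) fun m => d (ρ m) := by
  obtain ⟨f, hf, hfs⟩ := exists_injective_shadows hinf hw hd fun m => h (d m)
  obtain ⟨g, hg, hgs⟩ := exists_injective_shadows hinf hw hd fun m => h.symm (d m)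
  obtain ⟨ρ, hρ, hR⟩ := Function.Embedding.schroeder_bernstein_of_rel hf hg
    (fun a b => b = f a ∨ a = g b) (fun _ => .inl rfl) fun _ => .inr rfl
  refine ⟨Equiv.ofBijective ρ hρ, fun F hF z hz => ?_⟩
  change Tendsto (fun m => d (ρ m)) F (𝓝 z)
  rcases Ultrafilter.eventually_or.1 (Eventually.of_forall (f := (F : Filter ℕ)) hR) with h1 | h1
  · refine (hfs F hF z hz).congr' ?_
    filter_upwards [h1] with m hm
    rw [hm]
  · have hd' : Tendsto d F (𝓝 (h.symm z)) :=
      ((h.symm.continuous.tendsto z).comp hz).congr fun m => h.symm_apply_apply _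
    have hle : ((F.map ρ : Ultrafilter ℕ) : Filter ℕ) ≤ cofinite :=
      (map_mono hF).trans hρ.injective.tendsto_cofinite
    have h2 : Tendsto (fun m => d (g m)) (F.map ρ) (𝓝 (h.symm z)) := by
      rw [Ultrafilter.coe_map, tendsto_map'_iff]
      refine hd'.congr' ?_
      filter_upwards [h1] with m hm
      exact congrArg d hm
    have h3 := hgs.symm _ hle _ h2
    rw [Ultrafilter.coe_map, tendsto_map'_iff] at h3
    simpa [Function.comp_def] using (h.continuous.tendsto _).comp h3

end Pseudointersection

/-! ### Martin's axiom and pseudointersections -/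

section MartinsAxiom

open Filter Cardinal

/-- A condition of the forcing that adds a pseudointersection of `F`: a finite part of the
pseudointersection, together with finitely many members of `F` that contain all its further
elements. -/
structure PseudointersectionCondition (F : Set (Set ℕ)) where
  /-- The finite part of the pseudointersection. -/
  stem : Finset ℕ
  /-- The members of the family that contain all further elements. -/
  side : Finset F

namespace PseudointersectionCondition

variable {F : Set (Set ℕ)}

/-- A condition is extended by adding to its stem elements of the members of its side, and by
enlarging its side; extensions are smaller. -/
instance : Preorder (PseudointersectionCondition F) where
  le p q := q.stem ⊆ p.stem ∧ q.side ⊆ p.side ∧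
    ∀ n ∈ p.stem, n ∉ q.stem → ∀ B ∈ q.side, n ∈ B.1
  le_refl p := ⟨Finset.Subset.refl _, Finset.Subset.refl _, fun _ h1 h2 => absurd h1 h2⟩
  le_trans p q r hpq hqr := by
    refine ⟨hqr.1.trans hpq.1, hqr.2.1.trans hpq.2.1, fun n hn hnr B hB => ?_⟩
    by_cases hnq : n ∈ q.stem
    · exact hqr.2.2 n hnq hnr B hB
    · exact hpq.2.2 n hn hnq B (hqr.2.1 hB)

instance : Nonempty (PseudointersectionCondition F) := ⟨⟨∅, ∅⟩⟩

open scoped Classical in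
/-- Conditions with the same stem are compatible, so there are only countably many in an
antichain. -/
theorem countable_of_pairwise {A : Set (PseudointersectionCondition F)}
    (hA : A.Pairwise fun p q => ¬ ForcingCompatible p q) : A.Countable := by
  refine (mapsTo_univ stem A).countable_of_injOn (fun p hp q hq hpq => ?_) (to_countable _)
  by_contra hne
  refine hA hp hq hne ⟨⟨p.stem, p.side ∪ q.side⟩, ?_, ?_⟩
  · exact ⟨Finset.Subset.refl _, Finset.subset_union_left, fun _ h1 h2 => absurd h1 h2⟩
  · exact ⟨hpq.symm.subset, Finset.subset_union_right, fun _ h1 h2 => absurd (hpq ▸ h1) h2⟩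

end PseudointersectionCondition

open scoped Classical in
open PseudointersectionCondition in
theorem MartinsAxiom.exists_pseudointersection (hMA : MartinsAxiom) {F : Set (Set ℕ)}
    (hF : #F < 𝔠) (hfip : ∀ T : Set (Set ℕ), T ⊆ F → T.Finite → (⋂₀ T).Infinite) :
    ∃ A : Set ℕ, A.Infinite ∧ ∀ B ∈ F, (A \ B).Finite := by
  let D : ℕ ⊕ F → Set (PseudointersectionCondition F) :=
    Sum.elim (fun n => {p | ∃ k ∈ p.stem, n < k}) fun B => {p | B ∈ p.side}
  have hcard : #(range D) < 𝔠 := by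
    refine mk_range_le.trans_lt ?_
    rw [mk_sum, lift_uzero, lift_uzero, mk_nat]
    exact add_lt_of_lt aleph0_le_continuum aleph0_lt_continuum hF
  obtain ⟨G, -, -, hdir, hG⟩ := hMA (PseudointersectionCondition F)
    (fun A hA => countable_of_pairwise hA) (range D) hcard (by
      rintro _ ⟨n | B, rfl⟩ p
      · have hT : (⋂₀ (Subtype.val '' (p.side : Set F))).Infinite :=
          hfip _ (Subtype.coe_image_subset _ _) (p.side.finite_toSet.image _)
        obtain ⟨k, hk, hnk⟩ := hT.exists_gt n
        refine ⟨⟨insert k p.stem, p.side⟩, ⟨k, Finset.mem_insert_self _ _, hnk⟩,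
          Finset.subset_insert _ _, Finset.Subset.refl _, fun m hm hmp B hB => ?_⟩
        rw [(Finset.mem_insert.1 hm).resolve_right hmp]
        exact hk _ ⟨B, hB, rfl⟩
      · exact ⟨⟨p.stem, insert B p.side⟩, Finset.mem_insert_self _ _, Finset.Subset.refl _,
          Finset.subset_insert _ _, fun _ h1 h2 => absurd h1 h2⟩)
  refine ⟨{k | ∃ p ∈ G, k ∈ p.stem}, ?_, fun B hB => ?_⟩
  · refine infinite_of_forall_exists_gt fun n => ?_
    obtain ⟨p, hpG, k, hk, hnk⟩ := hG _ ⟨Sum.inl n, rfl⟩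
    exact ⟨k, ⟨p, hpG, hk⟩, hnk⟩
  · obtain ⟨p, hpG, hpB⟩ := hG _ ⟨Sum.inr ⟨B, hB⟩, rfl⟩
    refine p.stem.finite_toSet.subset ?_
    rintro k ⟨⟨q, hqG, hk⟩, hkB⟩
    obtain ⟨r, -, hrp, hrq⟩ := hdir p hpG q hqG
    by_contra hkp
    exact hkB (hrp.2.2 k (hrq.1 hk) hkp ⟨B, hB⟩ hpB)

/-- A nonprincipal ultrafilter has no infinite pseudointersection, because an infinite set splits
into two infinite parts. -/
theorem exists_family_without_pseudointersection : ∃ F : Set (Set ℕ),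
    (∀ T : Set (Set ℕ), T ⊆ F → T.Finite → (⋂₀ T).Infinite) ∧
      ¬ ∃ A : Set ℕ, A.Infinite ∧ ∀ B ∈ F, (A \ B).Finite := by
  refine ⟨{s | s ∈ hyperfilter ℕ}, fun T hT hfin => ?_, ?_⟩
  · exact infinite_of_mem_of_le_cofinite (hyperfilter_le_cofinite (α := ℕ))
      ((sInter_mem hfin).2 fun s hs => hT hs)
  · rintro ⟨A, hA, h⟩
    -- the elements of even and of odd position in `A`
    let e : ℕ → ℕ := Nat.nth (· ∈ A)
    have he : Function.Injective e := Nat.nth_injective hA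
    have heA : ∀ n, e n ∈ A := Nat.nth_mem_of_infinite hA
    let S : Set ℕ := range fun n => e (2 * n)
    rcases (hyperfilter ℕ).mem_or_compl_mem S with hS | hS
    · have hinf : (range fun n => e (2 * n + 1)).Infinite :=
        infinite_range_of_injective fun m n hmn => by have := he hmn; omega
      refine hinf ((h S hS).subset ?_)
      rintro _ ⟨n, rfl⟩
      refine ⟨heA _, ?_⟩
      rintro ⟨m, hm⟩
      have := he hm
      omega
    · have hinf : S.Infinite :=
        infinite_range_of_injective fun m n hmn => by have := he hmn; omega
      refine hinf ((h _ hS).subset ?_)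
      rintro _ ⟨n, rfl⟩
      exact ⟨heA _, fun hn => hn ⟨n, rfl⟩⟩

theorem MartinsAxiom.continuum_le (hMA : MartinsAxiom) : 𝔠 ≤ pseudointersectionNumber := by
  obtain ⟨F, hF, hA⟩ := exists_family_without_pseudointersection
  refine le_csInf ⟨_, F, hF, hA, rfl⟩ ?_
  rintro _ ⟨F, hF, hA, rfl⟩
  by_contra! hlt
  exact hA (hMA.exists_pseudointersection hlt hF)

end MartinsAxiom

/-! ### Cardinality of homogeneous spaces and of compact spaces -/

section Cardinality

open Filter Cardinal

variable {X : Type u} [TopologicalSpace X]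

/-- An autohomeomorphism `h` of a Hausdorff space is determined by the pairs `(V, W)` of members
of a π-base such that `W ⊆ h(V)`. -/
theorem IsPiBase.mk_homeomorph_le [T2Space X] {B : Set (Set X)} (hB : IsPiBase B) :
    #(X ≃ₜ X) ≤ 2 ^ #(B × B) := by
  rw [← mk_set]
  refine mk_le_of_injective (f := fun h : X ≃ₜ X => {q : B × B | q.2.1 ⊆ h '' q.1.1})
    fun g h hgh => ?_
  by_contra hne
  obtain ⟨x, hx⟩ : ∃ x, g x ≠ h x := by
    by_contra! H
    exact hne (Homeomorph.ext H)
  obtain ⟨O, O', hO, hO', hxO, hxO', hdisj⟩ := t2_separation hx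
  obtain ⟨V, hV, hVs⟩ := hB.2 (g ⁻¹' O ∩ h ⁻¹' O')
    ((hO.preimage g.continuous).inter (hO'.preimage h.continuous)) ⟨x, hxO, hxO'⟩
  obtain ⟨W, hW, hWs⟩ := hB.2 (g '' V) (g.isOpenMap _ (hB.1 V hV).1) ((hB.1 V hV).2.image g)
  have h1 : ((⟨V, hV⟩, ⟨W, hW⟩) : B × B) ∈ {q : B × B | q.2.1 ⊆ g '' q.1.1} := hWs
  have h2 : W ⊆ h '' V := (Set.ext_iff.1 hgh (⟨V, hV⟩, ⟨W, hW⟩)).1 h1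
  obtain ⟨w, hw⟩ := (hB.1 W hW).2
  obtain ⟨v, hv, rfl⟩ := hWs hw
  obtain ⟨v', hv', hvv⟩ := h2 hw
  exact disjoint_left.1 hdisj (hVs hv).1 (hvv ▸ (hVs hv').2)

theorem IsHomogeneousSpace.mk_le_continuum [T2Space X] (h : IsHomogeneousSpace X)
    (hpi : piWeight X = ℵ₀) : #X ≤ 𝔠 := by
  rcases isEmpty_or_nonempty X with hX | ⟨⟨x⟩⟩
  · simp
  obtain ⟨B, hB, hc⟩ : ∃ B : Set (Set X), IsPiBase B ∧ #B = piWeight X :=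
    csInf_mem (s := {κ | ∃ B : Set (Set X), IsPiBase B ∧ #B = κ})
      ⟨_, {V | IsOpen V ∧ V.Nonempty}, ⟨fun _ hV => hV, fun O hO hne => ⟨O, ⟨hO, hne⟩, Subset.rfl⟩⟩,
        rfl⟩
  have h1 : #X ≤ #(X ≃ₜ X) := mk_le_of_surjective (f := fun g : X ≃ₜ X => g x) (h x)
  refine h1.trans (hB.mk_homeomorph_le.trans_eq ?_)
  rw [mk_prod, lift_id, hc, hpi, aleph0_mul_aleph0, two_power_aleph0]

/-- In a compact Hausdorff space a `G_δ` point has a countable local base. -/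
theorem IsGδ.pointCharacter_le_aleph0 [CompactSpace X] [T2Space X] {x : X}
    (hx : IsGδ ({x} : Set X)) : pointCharacter x ≤ ℵ₀ := by
  obtain ⟨f, hf, hxf⟩ := isGδ_iff_eq_iInter_nat.1 hx
  have hmem : ∀ n, f n ∈ 𝓝 x := fun n =>
    (hf n).mem_nhds (mem_iInter.1 (hxf.subset (mem_singleton x)) n)
  choose V hV hVc hVf using fun n => exists_mem_nhds_isClosed_subset (hmem n)
  let K : ℕ → Set X := fun n => ⋂ k ∈ Finset.range (n + 1), V k
  have hKc : ∀ n, IsClosed (K n) := fun n => isClosed_biInter fun k _ => hVc k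
  have hKx : ∀ n, K n ∈ 𝓝 x := fun n => (biInter_finset_mem _).2 fun k _ => hV k
  have hKV : ∀ n, K n ⊆ V n := fun n => biInter_subset_of_mem (by simp)
  have hanti : Antitone K := fun m n hmn =>
    biInter_subset_biInter_left fun k hk => by simp at hk ⊢; omega
  refine le_trans (IsLocalBase.pointCharacter_le (B := range fun n => interior (K n))
    ⟨?_, fun O hO hxO => ?_⟩) (countable_range _).le_aleph0
  · rintro _ ⟨n, rfl⟩
    exact ⟨isOpen_interior, mem_interior_iff_mem_nhds.2 (hKx n)⟩
  · obtain ⟨n, hn⟩ := exists_subset_nhds_of_isCompact' (U := O) hanti.directed_ge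
      (fun n => (hKc n).isCompact) hKc fun y hy => by
        have hyx : y ∈ ({x} : Set X) := by
          rw [hxf]
          exact mem_iInter.2 fun n => hVf n (hKV n (mem_iInter.1 hy n))
        rw [mem_singleton_iff.1 hyx]
        exact hO.mem_nhds hxO
    exact ⟨_, ⟨n, rfl⟩, interior_subset.trans hn⟩

/-- If no point is a `G_δ`, then a nonempty closed `G_δ` set has a nonempty closed `G_δ` subset
that misses a given point. -/
theorem exists_subset_isClosed_isGδ_notMem [CompactSpace X] [T2Space X]
    (hX : ∀ x : X, ¬ IsGδ ({x} : Set X)) {K : Set X} (hne : K.Nonempty) (hK : IsClosed K)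
    (hKδ : IsGδ K) (y : X) : ∃ L ⊆ K, L.Nonempty ∧ IsClosed L ∧ IsGδ L ∧ y ∉ L := by
  obtain ⟨x, hxK, hxy⟩ : ∃ x ∈ K, x ≠ y := by
    by_contra! H
    exact hX y ((hne.subset_singleton_iff.1 H) ▸ hKδ)
  obtain ⟨f, hf0, hf1, -⟩ := exists_continuous_zero_one_of_isClosed (isClosed_singleton (x := x))
    (isClosed_singleton (x := y)) (disjoint_singleton.2 hxy)
  have hc : IsClosed (f ⁻¹' {0}) := isClosed_singleton.preimage f.continuous
  have hδ : IsGδ (f ⁻¹' {0}) := (IsGδ.singleton (0 : ℝ)).preimage f.continuous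
  refine ⟨K ∩ f ⁻¹' {0}, inter_subset_left, ⟨x, hxK, hf0 rfl⟩, hK.inter hc, hKδ.inter hδ,
    fun h => ?_⟩
  exact zero_ne_one ((show f y = 0 from h.2).symm.trans (hf1 rfl))

/-- A nonempty compact Hausdorff space in which every point has uncountable character has more
than `ℵ₁` points: a decreasing chain of length `ω₁` of closed `G_δ` sets can be made to miss any
`ℵ₁` given points. -/
theorem aleph_one_lt_mk [CompactSpace X] [T2Space X] [Nonempty X]
    (hX : ∀ x : X, ℵ₀ < pointCharacter x) : ℵ_ 1 < #X := by
  have hδ : ∀ x : X, ¬ IsGδ ({x} : Set X) := fun x hx => (hX x).not_ge hx.pointCharacter_le_aleph0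
  by_contra! hle
  let I : Type u := (ℵ_ 1).ord.ToType
  have hI : #I = ℵ_ 1 := mk_ord_toType _
  have hcount : ∀ i : I, (Iio i).Countable := fun i => by
    have h1 : #(Iio i) < #I := mk_Iio_lt i (by rw [hI]; exact (Ordinal.type_toType _).symm)
    exact le_aleph0_iff_set_countable.1 (lt_aleph_one_iff.1 (h1.trans_eq hI))
  obtain ⟨emb⟩ : #X ≤ #I := hle.trans_eq hI.symm
  let e : I → X := Function.invFun emb
  have he : Function.Surjective e := Function.invFun_surjective emb.injective
  let Good : Set X → Prop := fun K => K.Nonempty ∧ IsClosed K ∧ IsGδ K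
  have hstep : ∀ (K : Set X) (y : X), ∃ L, Good K → L ⊆ K ∧ Good L ∧ y ∉ L := fun K y => by
    by_cases hK : Good K
    · obtain ⟨L, h1, h2, h3, h4, h5⟩ :=
        exists_subset_isClosed_isGδ_notMem hδ hK.1 hK.2.1 hK.2.2 y
      exact ⟨L, fun _ => ⟨h1, ⟨h2, h3, h4⟩, h5⟩⟩
    · exact ⟨∅, fun h => absurd h hK⟩
  choose step hstep using hstep
  let F : I → Set X := (wellFounded_lt (α := I)).fix fun i F => step (⋂ j, ⋂ h : j < i, F j h) (e i)
  have hF : ∀ i, F i = step (⋂ j, ⋂ _ : j < i, F j) (e i) := fun i =>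
    (wellFounded_lt (α := I)).fix_eq _ i
  have key : ∀ i, Good (⋂ j, ⋂ _ : j < i, F j) := by
    intro i
    induction i using WellFoundedLT.induction with
    | ind i ih =>
      have hgood : ∀ j < i, F j ⊆ (⋂ k, ⋂ _ : k < j, F k) ∧ Good (F j) := fun j hj => by
        have h1 := hstep _ (e j) (ih j hj)
        rw [← hF] at h1
        exact ⟨h1.1, h1.2.1⟩
      refine ⟨?_, isClosed_biInter fun j hj => (hgood j hj).2.2.1,
        IsGδ.biInter (hcount i) fun j hj => (hgood j hj).2.2.2⟩
      have hdir : Directed (· ⊇ ·) fun j : Iio i => F j := by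
        refine Antitone.directed_ge fun j k hjk => ?_
        rcases hjk.lt_or_eq with h | rfl
        · exact (hgood k k.2).1.trans (biInter_subset_of_mem (t := fun j => F j) h)
        · exact Subset.rfl
      rcases isEmpty_or_nonempty (Iio i) with hemp | hne
      · rw [show (⋂ j, ⋂ _ : j < i, F j) = Set.univ from
          eq_univ_of_forall fun _ => mem_iInter₂.2 fun j hj => (hemp.false ⟨j, hj⟩).elim]
        exact univ_nonempty
      · have h2 := IsCompact.nonempty_iInter_of_directed_nonempty_isCompact_isClosed _ hdir
          (fun j => (hgood j j.2).2.1) (fun j => (hgood j j.2).2.2.1.isCompact)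
          fun j => (hgood j j.2).2.2.1
        rwa [iInter_subtype] at h2
  have hgood : ∀ j, F j ⊆ (⋂ k, ⋂ _ : k < j, F k) ∧ Good (F j) ∧ e j ∉ F j := fun j => by
    have h1 := hstep _ (e j) (key j)
    rwa [← hF] at h1
  have hdir : Directed (· ⊇ ·) F := by
    refine Antitone.directed_ge fun j k hjk => ?_
    rcases hjk.lt_or_eq with h | rfl
    · exact (hgood k).1.trans (biInter_subset_of_mem (t := fun j => F j) h)
    · exact Subset.rfl
  have hne : Nonempty I := (mk_ne_zero_iff).1 (by rw [hI]; exact (aleph_pos 1).ne')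
  obtain ⟨y, hy⟩ := IsCompact.nonempty_iInter_of_directed_nonempty_isCompact_isClosed F hdir
    (fun j => (hgood j).2.1.1) (fun j => (hgood j).2.1.2.1.isCompact) fun j => (hgood j).2.1.2.1
  obtain ⟨i, rfl⟩ := he y
  exact (hgood i).2.2 (mem_iInter.1 hy i)

end Cardinality

/-! ### Properties of the resolution -/

theorem mainTheorem2 {Y : Type u} [TopologicalSpace Y] [CompactSpace Y] [T2Space Y]
    (hhom : IsHomogeneousSpace Y)
    (hweight : topWeight Y = Cardinal.aleph 1)
    (hchar : topCharacter Y = Cardinal.aleph 1)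
    (η : Y ≃ₜ Y) (d : Y) (hdense : Dense (Set.range fun n : ℕ => η^[n] d))
    (hretract : IsRetractOfCompactificationsOfNat Y) :
    CompactSpace (CantorResolution η d) ∧
    T2Space (CantorResolution η d) ∧
    topCharacter (CantorResolution η d) = Cardinal.aleph 1 ∧
    piWeight (CantorResolution η d) = Cardinal.aleph0 ∧
    (IsZeroDimensional Y → IsZeroDimensional (CantorResolution η d)) ∧
    (MartinsAxiom → ¬ ContinuumHypothesis → IsHomogeneousSpace (CantorResolution η d)) ∧
    (topWeight Y < Cardinal.lift.{u} pseudointersectionNumber →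
      IsHomogeneousSpace (CantorResolution η d)) ∧
    (ContinuumHypothesis → ¬ IsHomogeneousSpace (CantorResolution η d)) := by
  have : Infinite Y := infinite_of_topWeight_eq hweight
  have : ∀ y : Y, (𝓝[≠] y).NeBot := hhom.neBot_nhdsNE
  have hd : ∀ W : Set Y, IsOpen W → W.Nonempty → {m | η^[m] d ∈ W}.Infinite :=
    fun W hW hne => infinite_setOf_mem_of_denseRange hdense hW hne
  have hpi : piWeight (CantorResolution η d) = Cardinal.aleph0 :=
    CantorResolution.piWeight_eq hd
  have hp : topWeight Y < Cardinal.lift.{u} pseudointersectionNumber →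
      IsHomogeneousSpace (CantorResolution η d) := fun hw =>
    CantorResolution.isHomogeneousSpace_of_forall_shadows hhom fun h =>
      exists_perm_shadows (hweight ▸ Cardinal.aleph0_le_aleph 1) hw hd h
  refine ⟨inferInstance, inferInstance, ?_, hpi, CantorResolution.isZeroDimensional, ?_, hp, ?_⟩
  · rw [CantorResolution.topCharacter_eq (hchar ▸ Cardinal.aleph0_le_aleph 1), hchar]
  · intro hMA hCH
    apply hp
    have h1 : Cardinal.aleph.{0} 1 < Cardinal.continuum :=
      Cardinal.aleph_one_le_continuum.lt_of_ne hCH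
    have h2 := Cardinal.lift_lt.{0, u}.2 (h1.trans_le hMA.continuum_le)
    rwa [Cardinal.lift_aleph, Ordinal.lift_one, ← hweight] at h2
  · intro hCH hX
    have h1 : Cardinal.aleph.{u} 1 < Cardinal.mk Y := aleph_one_lt_mk fun y => by
      rw [hhom.pointCharacter_eq y, hchar]
      exact Cardinal.aleph0_lt_aleph_one
    have h2 : Cardinal.mk Y ≤ Cardinal.mk (CantorResolution η d) :=
      Cardinal.mk_le_of_injective (f := CantorResolution.fiberMap η d fun _ => false)
        fun _ _ h => congrArg Prod.snd h
    have h3 : Cardinal.aleph.{u} 1 = Cardinal.continuum.{u} := by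
      have h4 := congrArg Cardinal.lift.{u}
        (show Cardinal.aleph.{0} 1 = Cardinal.continuum from hCH)
      rwa [Cardinal.lift_aleph, Ordinal.lift_one, Cardinal.lift_continuum] at h4
    exact (h1.trans_le (h2.trans (hX.mk_le_continuum hpi))).ne h3
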